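/- A graph consists of a set $V$ of vertices, a set $D$ of directed edges, maps $s,t\colon D\to V$ (source and target), and an involution $e\mapsto\bar e$ of $D$ with $\bar e\neq e$ and $s(\bar e)=t(e)$; loops and multiple edges are allowed. Its unoriented edges are the elements $\mathsf e=\{e,\bar e\}$ of $E=D/(e\sim\bar e)$. It is finite if $V$ and $D$ are finite, and connected if any two vertices are joined by a path. A morphism of graphs $p\colon\widetilde G\to G$ is a pair of maps on vertices and on directed edges that commutes with $s$, $t$ and the involutions. It is a covering map if it is surjective on vertices and if, for each vertex $\tilde v$ of $\widetilde G$, it maps the directed edges with source (respectively target) $\tilde v$ bijectively onto the directed edges of $G$ with source (respectively target) $p(\tilde v)$; then $\widetilde G$ is called a covering graph of $G$. A spanning forest of a finite graph $G$ is a subgraph $F\subset G$ that contains all vertices of $G$ and has no circuit, where a circuit is a closed path $(e_1,\dots,e_n)$, $n\ge 1$, with $e_{i+1}\neq\bar e_i$ for $1\le i<n$, with $e_1\neq\bar e_n$, and with $t(e_1),\dots,t(e_n)$ distinct. A spanning tree is a non-empty connected spanning forest. For a spanning forest $F$ with connected components $T_1,\dots,T_k$, let $\phi(F)=\prod_{j}|V(T_j)|$.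 For edge-weights $\mathsf x=(\mathsf x_{\mathsf e})_{\mathsf e\in E}$ on $G$, set $$Z_{ST}(G,\mathsf x)=\sum_{T}\ \prod_{\mathsf e\in E(T)}\mathsf x_{\mathsf e},\qquad Z_{RSF}(G,\mathsf x)=\sum_{F}\phi(F)\prod_{\mathsf e\in E(F)}\mathsf x_{\mathsf e},$$ where the sums are over all spanning trees $T$, respectively all spanning forests $F$, of $G$. **Theorem.** Let $G$ be a finite connected graph with edge-weights $\mathsf x=(\mathsf x_{\mathsf e})_{\mathsf e\in E}$ that are independent formal variables. Let $p\colon\widetilde G\to G$ be a covering map with $\widetilde G$ a finite graph (not necessarily connected), and let $\tilde{\mathsf x}$ be the lifted weights $\tilde{\mathsf x}_{\tilde{\mathsf e}}=\mathsf x_{p(\tilde{\mathsf e})}$. Then, in the polynomial ring $\mathbb Z[\mathsf x]$, $Z_{ST}(G,\mathsf x)$ divides $Z_{ST}(\widetilde G,\tilde{\mathsf x})$, and $Z_{RSF}(G,\mathsf x)$ divides $Z_{RSF}(\widetilde G,\tilde{\mathsf x})$. -/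

import Mathlib

/-- A graph in the sense of Serre with vertex set `V` and set of directed edges `D`: loops and
multiple edges are allowed, and every directed edge has an inverse, distinct from itself. -/
structure SerreGraph (V D : Type*) where
  src : D → V
  tgt : D → V
  bar : D → D
  bar_bar : ∀ e, bar (bar e) = e
  bar_ne : ∀ e, bar e ≠ e
  src_bar : ∀ e, src (bar e) = tgt e

namespace SerreGraph

universe u v u' v' w

variable {V : Type u} {D : Type v} {V' : Type u'} {D' : Type v'}

theorem tgt_bar (G : SerreGraph V D) (e : D) : G.tgt (G.bar e) = G.src e := by
  rw [← G.src_bar, G.bar_bar]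

/-- The relation identifying each directed edge with its inverse. -/
def edgeSetoid (G : SerreGraph V D) : Setoid D where
  r e f := f = e ∨ f = G.bar e
  iseqv :=
    { refl := fun _ => Or.inl rfl
      symm := by
        rintro e f (rfl | rfl)
        · exact Or.inl rfl
        · exact Or.inr (G.bar_bar e).symm
      trans := by
        rintro e f g (rfl | rfl) (rfl | rfl)
        · exact Or.inl rfl
        · exact Or.inr rfl
        · exact Or.inr rfl
        · exact Or.inl (G.bar_bar e) }

/-- The set of unoriented edges. -/
def Edge (G : SerreGraph V D) : Type v := Quotient G.edgeSetoid

/-- The unoriented edge underlying a directed edge. -/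
def edge (G : SerreGraph V D) (e : D) : G.Edge := Quotient.mk G.edgeSetoid e

theorem edge_bar (G : SerreGraph V D) (e : D) : G.edge (G.bar e) = G.edge e :=
  Quotient.sound (s := G.edgeSetoid) (Or.inr (G.bar_bar e).symm)

noncomputable instance instFintypeEdge [Fintype D] (G : SerreGraph V D) : Fintype G.Edge :=
  @Fintype.ofFinite _ (inferInstanceAs (Finite (Quotient G.edgeSetoid)))

/-- `G.Reachable v w`: there is a path (possibly of length zero) from `v` to `w`. -/
def Reachable (G : SerreGraph V D) : V → V → Prop :=
  Relation.ReflTransGen (fun v w => ∃ e, G.src e = v ∧ G.tgt e = w)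

/-- Any two vertices are joined by a path. -/
def Connected (G : SerreGraph V D) : Prop := ∀ v w, G.Reachable v w

/-- A circuit of length `n ≥ 1`: a closed path `e 0, …, e (n - 1)` without backtracking (also
cyclically) whose edges have distinct targets. Addition in `Fin n` is modulo `n`, so that the
successor of the last index is `0`. -/
structure IsCircuit (G : SerreGraph V D) {n : ℕ} [NeZero n] (e : Fin n → D) : Prop where
  tgt_eq_src : ∀ i, G.tgt (e i) = G.src (e (i + 1))
  ne_bar : ∀ i, e (i + 1) ≠ G.bar (e i)
  tgt_injective : Function.Injective (fun i => G.tgt (e i))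

/-- The graph has no circuit. -/
def Acyclic (G : SerreGraph V D) : Prop :=
  ∀ (n : ℕ) [NeZero n] (e : Fin n → D), ¬ G.IsCircuit e

/-- The subgraph with all the vertices of `G`, and with set of unoriented edges `S`. -/
def spanningSubgraph (G : SerreGraph V D) (S : Finset G.Edge) :
    SerreGraph V {e : D // G.edge e ∈ S} where
  src e := G.src e
  tgt e := G.tgt e
  bar e := ⟨G.bar e, by rw [G.edge_bar]; exact e.2⟩
  bar_bar e := Subtype.ext (G.bar_bar e)
  bar_ne e h := G.bar_ne e (congrArg Subtype.val h)
  src_bar e := G.src_bar e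

/-- The set `S` of edges is the edge set of a spanning forest. -/
def IsSpanningForest (G : SerreGraph V D) (S : Finset G.Edge) : Prop :=
  (G.spanningSubgraph S).Acyclic

/-- The set `S` of edges is the edge set of a spanning tree: with all the vertices of `G`, it
forms a non-empty connected subgraph without circuit. -/
def IsSpanningTree (G : SerreGraph V D) (S : Finset G.Edge) : Prop :=
  Nonempty V ∧ (G.spanningSubgraph S).Connected ∧ (G.spanningSubgraph S).Acyclic

/-- The relation of being joined by a path. -/
def reachableSetoid (G : SerreGraph V D) : Setoid V where
  r := G.Reachable
  iseqv :=
    { refl := fun _ => Relation.ReflTransGen.refl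
      symm := by
        intro v w h
        induction h with
        | refl => exact Relation.ReflTransGen.refl
        | tail _ h ih =>
          obtain ⟨e, rfl, rfl⟩ := h
          exact Relation.ReflTransGen.head ⟨G.bar e, G.src_bar e, G.tgt_bar e⟩ ih
      trans := fun h h' => Relation.ReflTransGen.trans h h' }

/-- The set of connected components. -/
def Component (G : SerreGraph V D) : Type u := Quotient G.reachableSetoid

/-- The connected component of a vertex. -/
def component (G : SerreGraph V D) (v : V) : G.Component := Quotient.mk G.reachableSetoid v

noncomputable instance instFintypeComponent [Fintype V] (G : SerreGraph V D) :
    Fintype G.Component :=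
  @Fintype.ofFinite _ (inferInstanceAs (Finite (Quotient G.reachableSetoid)))

/-- The product over all connected components of their numbers of vertices, i.e. the number of
ways to choose one root in each component. -/
noncomputable def numRoots [Fintype V] (G : SerreGraph V D) : ℕ :=
  ∏ c : G.Component, Nat.card {v : V // G.component v = c}

open scoped Classical in
/-- The spanning tree partition function of `G` with edge-weights `x`. -/
noncomputable def spanningTreePartition [Fintype D] {R : Type w} [CommSemiring R]
    (G : SerreGraph V D) (x : G.Edge → R) : R :=
  ∑ T : Finset G.Edge with G.IsSpanningTree T, ∏ e ∈ T, x e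

open scoped Classical in
/-- The rooted spanning forest partition function of `G` with edge-weights `x`. -/
noncomputable def rootedSpanningForestPartition [Fintype V] [Fintype D] {R : Type w}
    [CommSemiring R] (G : SerreGraph V D) (x : G.Edge → R) : R :=
  ∑ F : Finset G.Edge with G.IsSpanningForest F,
    ((G.spanningSubgraph F).numRoots : R) * ∏ e ∈ F, x e

/-- A morphism of graphs. -/
structure Hom (G' : SerreGraph V' D') (G : SerreGraph V D) where
  onVert : V' → V
  onDart : D' → D
  src_onDart : ∀ e, G.src (onDart e) = onVert (G'.src e)
  tgt_onDart : ∀ e, G.tgt (onDart e) = onVert (G'.tgt e)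
  onDart_bar : ∀ e, onDart (G'.bar e) = G.bar (onDart e)

/-- A covering map: surjective on vertices, and bijective from the edges leaving (entering) each
vertex to the edges leaving (entering) its image. -/
structure Hom.IsCovering {G' : SerreGraph V' D'} {G : SerreGraph V D} (p : G'.Hom G) : Prop where
  surjective : Function.Surjective p.onVert
  bijOn_src : ∀ v, Set.BijOn p.onDart {e | G'.src e = v} {e | G.src e = p.onVert v}
  bijOn_tgt : ∀ v, Set.BijOn p.onDart {e | G'.tgt e = v} {e | G.tgt e = p.onVert v}

/-- The map on unoriented edges induced by a morphism. -/
def Hom.onEdge {G' : SerreGraph V' D'} {G : SerreGraph V D} (p : G'.Hom G) : G'.Edge → G.Edge :=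
  Quotient.lift (s := G'.edgeSetoid) (fun e => G.edge (p.onDart e)) (by
    rintro e f (rfl | rfl)
    · rfl
    · rw [p.onDart_bar, G.edge_bar])

/-- The lift of edge-weights along a morphism. -/
def Hom.liftWeight {G' : SerreGraph V' D'} {G : SerreGraph V D} (p : G'.Hom G) {R : Type w}
    (x : G.Edge → R) : G'.Edge → R :=
  fun e => x (p.onEdge e)

end SerreGraph

/-!
Both divisibilities come from the determinant of `t + L`, where `L` is the weighted Laplacian.

*Matrix-forest theorem* (`SerreGraph.det_laplacian`): `det (t + L)` is the generating function of
rooted spanning forests in which `t` counts components, `SerreGraph.forestPolynomial`. The row of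
`t + L` at a vertex `v` is a sum of one row for `t` and one row for each directed edge leaving `v`.
Hence the determinant is a sum over the maps which select one of these at each vertex, that is,
which either declare `v` to be a root or choose a directed edge leaving `v`. Such a map contributes
nothing if it has a cycle, and otherwise contributes the product of its weights, since the matrix is
then unitriangular. The maps without cycles (`SerreGraph.IsParentMap`) with a given set of edges `F`
exist only if `F` is a forest, and they correspond to the choices of a root in each component of `F`
(`SerreGraph.IsSpanningForest.card_isParentMap`).

*Coverings*: composition with the covering map embeds the functions on the vertices of `G` as a
direct summand of the functions on the vertices of the covering graph, and intertwines the two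
Laplacians. Hence `det (t + L)` divides `det (t + L')` for every `t` in every commutative ring
(`Matrix.det_dvd_det_of_sum_fiber`, `SerreGraph.Hom.IsCovering.forestPolynomial_dvd`).

For `t = 1` this is the statement on rooted spanning forests. For `t` a polynomial variable, the
constant terms vanish and the linear terms are the numbers of vertices times the spanning tree
partition functions, so that the spanning tree partition function of `G` divides that of the
covering graph up to a non-zero integer factor. As `G` is connected it has a spanning tree, so its
partition function has a coefficient `1`, and Gauss's lemma removes the integer factor
(`MvPolynomial.dvd_of_dvd_natCast_mul`).
-/

/-! ### Determinants -/

namespace Matrix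

open scoped Classical in
/-- If summing the columns of `M'` over the fibres of a surjection `π` gives the rows of `M`, i.e.
if composition with `π` intertwines `M` and `M'`, then `det M` divides `det M'`: the functions
constant on fibres form an invariant direct summand on which `M'` acts as `M`. -/
theorem det_dvd_det_of_sum_fiber {V V' R : Type*} [Fintype V] [Fintype V'] [CommRing R]
    (M : Matrix V V R) (M' : Matrix V' V' R) {π : V' → V} (hπ : Function.Surjective π)
    (h : ∀ v' w, ∑ w' with π w' = w, M' v' w' = M (π v') w) : M.det ∣ M'.det := by
  obtain ⟨s, hs⟩ := hπ.hasRightInverse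
  have hsi : Function.Injective s := hs.injective
  -- `V'` is the disjoint union of the image of the section `s` and of its complement.
  let φ : V ⊕ {u : V' // u ∉ Set.range s} ≃ V' :=
    (Equiv.sumCongr (Equiv.ofInjective s hsi) (Equiv.refl _)).trans
      (Equiv.sumCompl (· ∈ Set.range s))
  have φl : ∀ v, φ (Sum.inl v) = s v := fun v => rfl
  have φr : ∀ u, φ (Sum.inr u) = u.1 := fun u => rfl
  let N := M'.submatrix φ φ
  let U : Matrix {u : V' // u ∉ Set.range s} V R := of fun u w => if π u = w then 1 else 0
  have key : ∀ i w, N i (Sum.inl w) + ∑ u, N i (Sum.inr u) * U u w = M (π (φ i)) w := by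
    intro i w
    rw [← h, Finset.sum_filter, ← φ.sum_comp, Fintype.sum_sum_type]
    congr 1
    · simp [N, φl, hs _]
    · simp [N, U, φr]
  have e1 : N.toBlocks₁₁ + N.toBlocks₁₂ * U = M := by
    ext v w
    simpa [toBlocks₁₁, toBlocks₁₂, mul_apply, φl, hs _] using key (Sum.inl v) w
  have e2 : N.toBlocks₂₁ + N.toBlocks₂₂ * U = U * M := by
    ext u w
    have := key (Sum.inr u) w
    simpa [toBlocks₂₁, toBlocks₂₂, mul_apply, φr, U] using this
  -- Conjugation by a unipotent matrix makes the functions constant on fibres the first block.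
  have e3 : fromBlocks 1 0 (-U) 1 * N * fromBlocks 1 0 U 1 =
      fromBlocks M N.toBlocks₁₂ 0 (N.toBlocks₂₂ - U * N.toBlocks₁₂) := by
    conv_lhs => rw [← fromBlocks_toBlocks N]
    rw [fromBlocks_multiply, fromBlocks_multiply]
    congr 1
    · simpa using e1
    · simp
    · simp only [Matrix.one_mul, Matrix.mul_one]
      rw [Matrix.add_mul, add_add_add_comm, e2, Matrix.mul_assoc, ← Matrix.mul_add, e1]
      simp
    · simp [sub_eq_neg_add]
  have e4 := congrArg det e3
  rw [det_mul, det_mul, det_fromBlocks_zero₁₂, det_fromBlocks_zero₁₂, det_fromBlocks_zero₂₁] at e4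
  simp only [det_one, one_mul, mul_one] at e4
  rw [← det_submatrix_equiv_self φ M', e4]
  exact dvd_mul_right _ _

variable {V R : Type*} [Fintype V] [DecidableEq V] [CommRing R]

/-- `1 - N` has determinant one when `N` is the matrix of a partial map without cycles, since it is
unitriangular for the order by rank. -/
theorem det_eq_one_of_wellFounded (next : V → Option V) {M : Matrix V V R}
    (hM : ∀ v w, M v w = (if v = w then 1 else 0) - if next v = some w then 1 else 0)
    (wf : WellFounded fun w v => next v = some w) : M.det = 1 := by
  have : IsWellFounded V fun w v => next v = some w := ⟨wf⟩
  let b : V → Ordinalᵒᵈ := fun v =>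
    OrderDual.toDual (IsWellFounded.rank (fun w v => next v = some w) v)
  have hb : ∀ {v w}, next v = some w → b v < b w := fun h =>
    OrderDual.toDual_lt_toDual.2 (IsWellFounded.rank_lt_of_rel h)
  have tri : M.BlockTriangular b := by
    intro v w hvw
    rw [hM, if_neg, if_neg, sub_zero]
    · exact fun h => lt_asymm hvw (hb h)
    · rintro rfl
      exact lt_irrefl _ hvw
  rw [tri.det]
  refine Finset.prod_eq_one fun a _ => ?_
  have : M.toSquareBlock b a = 1 := by
    ext v w
    have hn : next v ≠ some w.1 := fun h => (hb h).ne (v.2.trans w.2.symm)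
    simp [toSquareBlock_def, hM, hn, one_apply, Subtype.ext_iff]
  rw [this, det_one]

/-- `1 - N` is singular when `N` is the matrix of a partial map with a cycle: it kills the
indicator function of the set of points whose forward orbit never ends. -/
theorem det_eq_zero_of_not_wellFounded (next : V → Option V) {M : Matrix V V R}
    (hM : ∀ v w, M v w = (if v = w then 1 else 0) - if next v = some w then 1 else 0)
    (wf : ¬ WellFounded fun w v => next v = some w) : M.det = 0 := by
  classical
  obtain ⟨v₀, hv₀⟩ : ∃ v, ¬ Acc (fun w v => next v = some w) v := by
    by_contra! h
    exact wf ⟨h⟩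
  let z : V → R := fun v => if Acc (fun w v => next v = some w) v then 0 else 1
  have hz : M *ᵥ z = 0 := by
    ext v
    simp only [mulVec, dotProduct, hM, sub_mul, Finset.sum_sub_distrib, ite_mul, one_mul, zero_mul,
      Finset.sum_ite_eq, Finset.mem_univ, if_true, Pi.zero_apply]
    cases hv : next v with
    | none =>
      have : Acc (fun w v => next v = some w) v := ⟨_, fun w hw => by simp [hv] at hw⟩
      simp [z, this]
    | some w =>
      have : Acc (fun w v => next v = some w) v ↔ Acc (fun w v => next v = some w) w :=
        ⟨fun h => h.inv hv, fun h => ⟨_, fun u hu => by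
          obtain rfl : w = u := by simpa [hv] using hu
          exact h⟩⟩
      simp [z, this]
  have h := congrFun (congrArg (M.adjugate *ᵥ ·) hz) v₀
  simpa [mulVec_mulVec, adjugate_mul, smul_mulVec, z, hv₀] using h

end Matrix

namespace SerreGraph

universe u v

/-! ### Edges and components -/

variable {V : Type u} {D : Type v}

theorem edge_eq_edge (G : SerreGraph V D) {e f : D} :
    G.edge e = G.edge f ↔ f = e ∨ f = G.bar e :=
  Quotient.eq (r := G.edgeSetoid)

theorem component_eq_component (G : SerreGraph V D) {v w : V} :
    G.component v = G.component w ↔ G.Reachable v w :=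
  Quotient.eq (r := G.reachableSetoid)

theorem Reachable.symm {G : SerreGraph V D} {v w : V} (h : G.Reachable v w) : G.Reachable w v :=
  G.reachableSetoid.symm h

theorem reachable_src_tgt (G : SerreGraph V D) (e : D) : G.Reachable (G.src e) (G.tgt e) :=
  Relation.ReflTransGen.single ⟨e, rfl, rfl⟩

theorem Reachable.mono {G : SerreGraph V D} {S T : Finset G.Edge} (hST : S ⊆ T) {v w : V}
    (h : (G.spanningSubgraph S).Reachable v w) : (G.spanningSubgraph T).Reachable v w :=
  Relation.ReflTransGen.mono (fun _ _ ⟨e, he⟩ => ⟨⟨e.1, hST e.2⟩, he⟩) _ _ h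

theorem card_component_eq_one_iff [Fintype V] (G : SerreGraph V D) :
    Fintype.card G.Component = 1 ↔ Nonempty V ∧ G.Connected := by
  rw [Fintype.card_eq_one_iff]
  constructor
  · rintro ⟨c, hc⟩
    refine ⟨⟨c.out⟩, fun v w => G.component_eq_component.1 ?_⟩
    rw [hc (G.component v), hc (G.component w)]
  · rintro ⟨⟨v⟩, h⟩
    refine ⟨G.component v, fun c => ?_⟩
    obtain ⟨w, rfl⟩ : ∃ w, G.component w = c := Quotient.exists_rep c
    exact G.component_eq_component.2 (h w v)

theorem numRoots_of_connected [Fintype V] {G : SerreGraph V D} (hV : Nonempty V) (h : G.Connected) :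
    G.numRoots = Fintype.card V := by
  obtain ⟨c, hc⟩ := Fintype.card_eq_one_iff.1 (G.card_component_eq_one_iff.2 ⟨hV, h⟩)
  have : Unique G.Component := ⟨⟨c⟩, hc⟩
  rw [numRoots, Fintype.prod_unique, ← Nat.card_eq_fintype_card]
  exact Nat.card_congr (Equiv.subtypeUnivEquiv fun v => Subsingleton.elim _ _)

/-! ### Distances and circuits -/

/-- There is a distance function: from each point that is joined to another point `b` by a path,
some step lowers the distance to `b` by exactly one. -/
theorem exists_dist {α : Type*} (r : α → α → Prop) : ∃ d : α → α → ℕ, (∀ b, d b b = 0) ∧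
    ∀ v b, Relation.ReflTransGen r v b → v ≠ b →
      ∃ w, r v w ∧ Relation.ReflTransGen r w b ∧ d v b = d w b + 1 := by
  classical
  let P : ℕ → α → α → Prop := fun n =>
    Nat.rec (fun v b => v = b) (fun _ ih v b => ∃ w, r v w ∧ ih w b) n
  have h0 : ∀ v b, P 0 v b ↔ v = b := fun _ _ => Iff.rfl
  have h1 : ∀ n v b, P (n + 1) v b ↔ ∃ w, r v w ∧ P n w b := fun _ _ _ => Iff.rfl
  have hP : ∀ n v b, P n v b → Relation.ReflTransGen r v b := by
    intro n
    induction n with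
    | zero => rintro v b h; rw [(h0 v b).1 h]
    | succ n ih =>
      intro v b h
      obtain ⟨w, hw, hn⟩ := (h1 _ _ _).1 h
      exact Relation.ReflTransGen.head hw (ih _ _ hn)
  have hR : ∀ v b, Relation.ReflTransGen r v b → ∃ n, P n v b := by
    intro v b h
    induction h using Relation.ReflTransGen.head_induction_on with
    | refl => exact ⟨0, rfl⟩
    | head h _ ih =>
      obtain ⟨n, hn⟩ := ih
      exact ⟨n + 1, _, h, hn⟩
  refine ⟨fun v b => sInf {n | P n v b}, fun b => Nat.sInf_eq_zero.2 (.inl ((h0 b b).2 rfl)),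
    fun v b h hne => ?_⟩
  have hm : P (sInf {n | P n v b}) v b := Nat.sInf_mem (s := {n | P n v b}) (hR v b h)
  generalize hk : sInf {n | P n v b} = k at hm
  cases k with
  | zero => exact absurd ((h0 _ _).1 hm) hne
  | succ k =>
    obtain ⟨w, hw, hn⟩ := (h1 _ _ _).1 hm
    refine ⟨w, hw, hP _ _ _ hn, ?_⟩
    have hle : sInf {n | P n w b} ≤ k := Nat.sInf_le hn
    have hmw : P (sInf {n | P n w b}) w b := Nat.sInf_mem (s := {n | P n w b}) ⟨k, hn⟩
    have hge : sInf {n | P n v b} ≤ sInf {n | P n w b} + 1 :=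
      Nat.sInf_le (s := {n | P n v b}) ((h1 _ _ _).2 ⟨w, hw, hmw⟩)
    simp only
    omega

open scoped Classical in
/-- Every edge of a spanning forest is a bridge: a shortest path joining the ends of an edge
without using it would close up to a circuit. -/
theorem IsSpanningForest.not_reachable_erase {G : SerreGraph V D} {S : Finset G.Edge}
    (hS : G.IsSpanningForest S) {e : D} (he : G.edge e ∈ S) :
    ¬ (G.spanningSubgraph (S.erase (G.edge e))).Reachable (G.tgt e) (G.src e) := by
  intro hr
  obtain ⟨d, hd0, hd⟩ := exists_dist (fun v w =>
    ∃ a, (G.spanningSubgraph (S.erase (G.edge e))).src a = v ∧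
      (G.spanningSubgraph (S.erase (G.edge e))).tgt a = w)
  have hg : ∀ v, ∃ a : D, (G.spanningSubgraph (S.erase (G.edge e))).Reachable v (G.src e) →
      v ≠ G.src e → G.edge a ∈ S.erase (G.edge e) ∧ G.src a = v ∧
        (G.spanningSubgraph (S.erase (G.edge e))).Reachable (G.tgt a) (G.src e) ∧
        d v (G.src e) = d (G.tgt a) (G.src e) + 1 := by
    intro v
    by_cases h : (G.spanningSubgraph (S.erase (G.edge e))).Reachable v (G.src e) ∧ v ≠ G.src e
    · obtain ⟨w, ⟨a, ha, rfl⟩, hw, hdw⟩ := hd v _ h.1 h.2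
      exact ⟨a.1, fun _ _ => ⟨a.2, ha, hw, hdw⟩⟩
    · exact ⟨e, fun h1 h2 => absurd ⟨h1, h2⟩ h⟩
  choose g hg using hg
  set b := G.src e with hb
  set m := d (G.tgt e) b with hm
  -- The circuit starts with `e`; each further edge is the chosen one leading closer to `b`.
  let E : ℕ → D := fun i => Nat.rec e (fun _ a => g (G.tgt a)) i
  have E0 : E 0 = e := rfl
  have E1 : ∀ i, E (i + 1) = g (G.tgt (E i)) := fun _ => rfl
  have hne : ∀ i, d (G.tgt (E i)) b + i = m → i < m → G.tgt (E i) ≠ b := fun i h2 hi h => by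
    rw [h, hd0] at h2
    omega
  have inv : ∀ i, i ≤ m → (G.spanningSubgraph (S.erase (G.edge e))).Reachable
      (G.tgt (E i)) b ∧ d (G.tgt (E i)) b + i = m := by
    intro i
    induction i with
    | zero => exact fun _ => ⟨hr, rfl⟩
    | succ i ih =>
      intro hi
      obtain ⟨h1, h2⟩ := ih (by omega)
      obtain ⟨-, -, h3, h4⟩ := hg _ h1 (hne i h2 (by omega))
      rw [← E1] at h3 h4
      exact ⟨h3, by omega⟩
  have step : ∀ i, i < m → G.edge (E (i + 1)) ∈ S.erase (G.edge e) ∧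
      G.src (E (i + 1)) = G.tgt (E i) := by
    intro i hi
    obtain ⟨h1, h2⟩ := inv i hi.le
    obtain ⟨h3, h4, -⟩ := hg _ h1 (hne i h2 hi)
    exact ⟨h3, h4⟩
  have hmem : ∀ i, i ≤ m → G.edge (E i) ∈ S := by
    rintro (_ | i) hi
    · exact he
    · exact Finset.mem_of_mem_erase (step i hi).1
  have last : G.tgt (E m) = b := by
    obtain ⟨h1, h2⟩ := inv m le_rfl
    by_contra h
    obtain ⟨-, -, -, h4⟩ := hg _ h1 h
    omega
  have hsucc : ∀ i : Fin (m + 1), (i.1 < m ∧ (i + 1).1 = i.1 + 1) ∨ (i.1 = m ∧ (i + 1).1 = 0) := by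
    intro i
    rw [Fin.val_add_one]
    split_ifs with h
    · exact .inr ⟨by simp [h], rfl⟩
    · exact .inl ⟨lt_of_le_of_ne (Nat.lt_succ_iff.1 i.2) fun h' => h (Fin.ext h'), rfl⟩
  refine hS (m + 1) (fun i => ⟨E i, hmem i (Nat.lt_succ_iff.1 i.2)⟩) ⟨fun i => ?_, fun i h => ?_,
    fun i j hij => ?_⟩
  · change G.tgt (E i) = G.src (E (i + 1 : Fin (m + 1)).1)
    rcases hsucc i with ⟨hi, h⟩ | ⟨hi, h⟩
    · rw [h, (step _ hi).2]
    · rw [h, hi, last, E0]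
  · replace h : E (i + 1 : Fin (m + 1)).1 = G.bar (E i) := congrArg Subtype.val h
    rcases hsucc i with ⟨hi, h'⟩ | ⟨hi, h'⟩
    · rw [h'] at h
      rcases hi0 : i.1 with _ | k
      · rw [hi0, E0] at h
        apply Finset.ne_of_mem_erase (step 0 (by omega)).1
        rw [h, G.edge_bar]
      · rw [hi0] at h hi
        have h1 := (inv (k + 1 + 1) (by omega)).2
        have h2 := (inv k (by omega)).2
        rw [h, G.tgt_bar, (step k (by omega)).2] at h1
        omega
    · rw [h', hi, E0] at h
      rcases hm0 : m with _ | k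
      · rw [hm0, E0] at h
        exact G.bar_ne e h.symm
      · rw [hm0] at h
        apply Finset.ne_of_mem_erase (step k (by omega)).1
        rw [h, G.edge_bar]
  · replace hij : G.tgt (E i) = G.tgt (E j) := hij
    have h1 := (inv i (Nat.lt_succ_iff.1 i.2)).2
    have h2 := (inv j (Nat.lt_succ_iff.1 j.2)).2
    rw [hij] at h1
    exact Fin.ext (by omega)

/-! ### Parent maps -/

/-- A parent map orients a spanning forest towards a choice of roots: it sends each root to `none`,
and each other vertex to a directed edge leaving it, such that following these edges always ends at
a root. The last condition is encoded as well-foundedness of the relation from a vertex to the next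
one. -/
structure IsParentMap (G : SerreGraph V D) (f : V → Option D) : Prop where
  src_eq : ∀ v e, f v = some e → G.src e = v
  wf : WellFounded fun w v => (f v).map G.tgt = some w

namespace IsParentMap

variable {G : SerreGraph V D} {f : V → Option D}

theorem induction (hf : G.IsParentMap f) {P : V → Prop} (root : ∀ v, f v = none → P v)
    (step : ∀ v e, f v = some e → P (G.tgt e) → P v) (v : V) : P v := by
  induction v using hf.wf.induction with
  | _ v ih =>
    cases hv : f v with
    | none => exact root v hv
    | some e => exact step v e hv (ih _ (by rw [hv]; rfl))

/-- The rank in the well-founded relation plays the role of the distance to the root. -/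
theorem lt_rank (hf : G.IsParentMap f) {v : V} {e : D} (h : f v = some e) :
    haveI : IsWellFounded V fun w v => (f v).map G.tgt = some w := ⟨hf.wf⟩
    IsWellFounded.rank (fun w v => (f v).map G.tgt = some w) (G.tgt e) <
      IsWellFounded.rank (fun w v => (f v).map G.tgt = some w) v := by
  have : IsWellFounded V fun w v => (f v).map G.tgt = some w := ⟨hf.wf⟩
  exact IsWellFounded.rank_lt_of_rel (by rw [h]; rfl)

/-- No edge is used in both directions. -/
theorem ne_bar (hf : G.IsParentMap f) {v : V} {e : D} (h : f v = some e) :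
    f (G.tgt e) ≠ some (G.bar e) := fun h' => by
  have h1 := hf.lt_rank h
  have h2 := hf.lt_rank h'
  rw [G.tgt_bar, hf.src_eq v e h] at h2
  exact lt_asymm h1 h2

/-- Different vertices have different unoriented parent edges, because no edge is used in both
directions. -/
theorem edge_injective (hf : G.IsParentMap f) {v w : V} {a b : D} (hv : f v = some a)
    (hw : f w = some b) (h : G.edge a = G.edge b) : v = w := by
  have h1 := hf.src_eq v a hv
  have h2 := hf.src_eq w b hw
  rcases G.edge_eq_edge.1 h with rfl | rfl
  · rw [← h1, h2]
  · rw [G.src_bar] at h2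
    subst h2
    exact absurd hw (hf.ne_bar hv)

theorem exists_root (hf : G.IsParentMap f) {T : Finset G.Edge}
    (hT : ∀ v e, f v = some e → G.edge e ∈ T) (v : V) :
    ∃ w, f w = none ∧ (G.spanningSubgraph T).Reachable v w := by
  induction v using hf.induction with
  | root v h => exact ⟨v, h, Relation.ReflTransGen.refl⟩
  | step v e h ih =>
    obtain ⟨w, hw, hr⟩ := ih
    exact ⟨w, hw, Relation.ReflTransGen.head ⟨⟨e, hT v e h⟩, hf.src_eq v e h, rfl⟩ hr⟩

/-- There is a map sending each vertex to the root at which its path ends. -/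
theorem exists_rootMap (hf : G.IsParentMap f) : ∃ ρ : V → V, (∀ v, f v = none → ρ v = v) ∧
    ∀ v e, f v = some e → ρ v = ρ (G.tgt e) := by
  let F : (v : V) → ((w : V) → (f v).map G.tgt = some w → V) → V := fun v ih =>
    match h : (f v).map G.tgt with
    | none => v
    | some w => ih w h
  have hF : ∀ v, hf.wf.fix F v = F v fun w _ => hf.wf.fix F w := fun v => hf.wf.fix_eq F v
  refine ⟨hf.wf.fix F, fun v hv => ?_, fun v e hv => ?_⟩
  · rw [hF]
    simp only [F]
    split
    · rfl
    · simp_all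
  · rw [hF]
    simp only [F]
    split
    · simp_all
    · rename_i w hw
      obtain rfl : G.tgt e = w := by simpa [hv] using hw
      rfl

end IsParentMap

variable [Fintype D]

open scoped Classical in
/-- The set of edges used by a parent map. -/
noncomputable def parentEdges (G : SerreGraph V D) (f : V → Option D) :
    Finset G.Edge :=
  Finset.univ.filter fun a => ∃ v e, f v = some e ∧ G.edge e = a

theorem mem_parentEdges {G : SerreGraph V D} {f : V → Option D} {a : G.Edge} :
    a ∈ G.parentEdges f ↔ ∃ v e, f v = some e ∧ G.edge e = a := by
  classical exact Finset.mem_filter.trans (and_iff_right (Finset.mem_univ _))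

theorem edge_mem_parentEdges {G : SerreGraph V D} {f : V → Option D} {v : V} {e : D}
    (h : f v = some e) : G.edge e ∈ G.parentEdges f :=
  mem_parentEdges.2 ⟨v, e, h, rfl⟩

namespace IsParentMap

variable {G : SerreGraph V D} {f f' : V → Option D}

theorem edge_mem_iff (hf : G.IsParentMap f) {e : D} :
    G.edge e ∈ G.parentEdges f ↔ f (G.src e) = some e ∨ f (G.tgt e) = some (G.bar e) := by
  classical
  constructor
  · intro h
    obtain ⟨v, a, ha, hae⟩ := mem_parentEdges.1 h
    have hs := hf.src_eq v a ha
    rcases G.edge_eq_edge.1 hae with rfl | rfl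
    · exact .inl (by rw [hs, ha])
    · right
      rw [G.tgt_bar, G.bar_bar, hs, ha]
  · rintro (h | h)
    · exact edge_mem_parentEdges h
    · rw [← G.edge_bar]
      exact edge_mem_parentEdges h

/-- At a vertex of maximal rank on a circuit, both edges of the circuit would have to be the edge
towards the parent. -/
theorem isSpanningForest (hf : G.IsParentMap f) : G.IsSpanningForest (G.parentEdges f) := by
  intro n _ c hc
  have : IsWellFounded V fun w v => (f v).map G.tgt = some w := ⟨hf.wf⟩
  obtain ⟨i, hi⟩ := Finite.exists_max fun i : Fin n =>
    IsWellFounded.rank (fun w v => (f v).map G.tgt = some w) (G.tgt (c i).1)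
  have hts : ∀ j, G.tgt (c j).1 = G.src (c (j + 1)).1 := hc.tgt_eq_src
  have h1 : f (G.tgt (c i).1) = some (G.bar (c i).1) := by
    rcases hf.edge_mem_iff.1 (c i).2 with h | h
    · have hlt := hf.lt_rank h
      have hle := hi (i - 1)
      rw [hts, sub_add_cancel] at hle
      exact absurd hlt (not_lt.2 hle)
    · exact h
  have h2 : f (G.tgt (c i).1) = some (c (i + 1)).1 := by
    rw [hts]
    rcases hf.edge_mem_iff.1 (c (i + 1)).2 with h | h
    · exact h
    · have hlt := hf.lt_rank h
      rw [G.tgt_bar, ← hts] at hlt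
      exact absurd hlt (not_lt.2 (hi (i + 1)))
  exact hc.ne_bar i (Subtype.ext (Option.some.inj (h2.symm.trans h1)))

/-- The root at which the path of a vertex ends is constant along the edges used. -/
theorem root_unique (hf : G.IsParentMap f) {v w : V} (hv : f v = none) (hw : f w = none)
    (h : (G.spanningSubgraph (G.parentEdges f)).Reachable v w) : v = w := by
  obtain ⟨ρ, h0, h1⟩ := hf.exists_rootMap
  have key : ρ v = ρ w := by
    clear hw
    induction h with
    | refl => rfl
    | tail _ h ih =>
      obtain ⟨e, rfl, rfl⟩ := h
      rw [ih]
      change ρ (G.src e.1) = ρ (G.tgt e.1)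
      rcases hf.edge_mem_iff.1 e.2 with h | h
      · exact h1 _ _ h
      · rw [h1 _ _ h, G.tgt_bar]
  rw [← h0 v hv, key, h0 w hw]

theorem existsUnique_root (hf : G.IsParentMap f)
    (c : (G.spanningSubgraph (G.parentEdges f)).Component) :
    ∃! v, f v = none ∧ (G.spanningSubgraph (G.parentEdges f)).component v = c := by
  obtain ⟨v, rfl⟩ : ∃ v, (G.spanningSubgraph (G.parentEdges f)).component v = c :=
    Quotient.exists_rep c
  obtain ⟨w, hw, hvw⟩ := hf.exists_root (fun _ _ h => edge_mem_parentEdges h) v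
  exact ⟨w, ⟨hw, (component_eq_component _).2 hvw.symm⟩, fun w' hw' =>
    hf.root_unique hw'.1 hw (((component_eq_component _).1 hw'.2).trans hvw)⟩

/-- A parent map is determined by its edges and its roots: two different parent edges at a vertex
would be followed by two different ones at the next vertex, and so on without end. -/
theorem eq_of_parentEdges_eq (hf : G.IsParentMap f) (hf' : G.IsParentMap f')
    (hE : G.parentEdges f = G.parentEdges f') (hr : ∀ v, f v = none ↔ f' v = none) : f = f' := by
  funext v
  induction v using hf.induction with
  | root v h => rw [h, (hr v).1 h]
  | step v e h ih =>
    have hs := hf.src_eq v e h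
    have he : G.edge e ∈ G.parentEdges f' := hE ▸ edge_mem_parentEdges h
    rcases hf'.edge_mem_iff.1 he with h' | h'
    · rw [h, ← h', hs]
    · exact absurd (ih.trans h') (hf.ne_bar h)

end IsParentMap

/-- For any choice of a root in each component of a spanning subgraph there is a parent map with
these roots: each vertex points along the first edge of a shortest path to its root. -/
theorem exists_isParentMap_subset (G : SerreGraph V D) (S : Finset G.Edge)
    (s : (G.spanningSubgraph S).Component → V)
    (hs : ∀ c, (G.spanningSubgraph S).component (s c) = c) :
    ∃ f, G.IsParentMap f ∧ G.parentEdges f ⊆ S ∧ ∀ v, f v = none ↔ v ∈ Set.range s := by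
  classical
  obtain ⟨d, -, hd⟩ := exists_dist (fun v w =>
    ∃ a, (G.spanningSubgraph S).src a = v ∧ (G.spanningSubgraph S).tgt a = w)
  let r : V → V := fun v => s ((G.spanningSubgraph S).component v)
  have hr : ∀ v, (G.spanningSubgraph S).Reachable v (r v) := fun v =>
    (component_eq_component _).1 (hs _).symm
  have hrr : ∀ v, v ∈ Set.range s ↔ v = r v := by
    refine fun v => ⟨?_, fun h => ⟨_, h.symm⟩⟩
    rintro ⟨c, rfl⟩
    simp only [r, hs]
  have hg : ∀ v, ∃ o : Option D, (o = none ↔ v = r v) ∧ ∀ e, o = some e → G.edge e ∈ S ∧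
      G.src e = v ∧ d v (r v) = d (G.tgt e) (r (G.tgt e)) + 1 := by
    intro v
    by_cases h : v = r v
    · exact ⟨none, by simp [h.symm], by simp⟩
    · obtain ⟨w, ⟨a, ha, rfl⟩, -, hdw⟩ := hd v _ (hr v) h
      refine ⟨some a.1, by simp [h], fun e he => ?_⟩
      obtain rfl : a.1 = e := Option.some.inj he
      have : r v = r (G.tgt a.1) := congrArg s ((component_eq_component _).2
        (ha ▸ (G.spanningSubgraph S).reachable_src_tgt a))
      rw [← this]
      exact ⟨a.2, ha, hdw⟩
  choose f hf0 hf1 using hg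
  refine ⟨f, ⟨fun v e h => (hf1 v e h).2.1, ?_⟩, fun a ha => ?_,
    fun v => (hf0 v).trans (hrr v).symm⟩
  · refine Subrelation.wf (r := InvImage (· < ·) fun v => d v (r v)) ?_
      (InvImage.wf _ wellFounded_lt)
    intro w v h
    obtain ⟨e, he, rfl⟩ := Option.map_eq_some_iff.1 h
    change d _ _ < d _ _
    rw [(hf1 v e he).2.2]
    exact Nat.lt_succ_self _
  · obtain ⟨v, e, he, rfl⟩ := mem_parentEdges.1 ha
    exact (hf1 v e he).1

/-- A spanning forest with a chosen root in each component comes from a parent map, because removing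
an edge would disconnect its ends from each other and so one of them from its root. -/
theorem IsSpanningForest.exists_isParentMap {G : SerreGraph V D} {S : Finset G.Edge}
    (hS : G.IsSpanningForest S) (s : (G.spanningSubgraph S).Component → V)
    (hs : ∀ c, (G.spanningSubgraph S).component (s c) = c) :
    ∃ f, G.IsParentMap f ∧ G.parentEdges f = S ∧ ∀ v, f v = none ↔ v ∈ Set.range s := by
  classical
  obtain ⟨f, hf, hfS, hroots⟩ := G.exists_isParentMap_subset S s hs
  refine ⟨f, hf, hfS.antisymm fun a ha => ?_, hroots⟩
  obtain ⟨e, rfl⟩ : ∃ e, G.edge e = a := Quotient.exists_rep a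
  by_contra hna
  have hT : ∀ v b, f v = some b → G.edge b ∈ S.erase (G.edge e) := fun v b h =>
    have hb := edge_mem_parentEdges h
    Finset.mem_erase.2 ⟨fun h' => hna (h' ▸ hb), hfS hb⟩
  have hroot : ∀ v, (G.spanningSubgraph (S.erase (G.edge e))).Reachable v
      (s ((G.spanningSubgraph S).component v)) := by
    intro v
    obtain ⟨w, hw, hvw⟩ := hf.exists_root hT v
    obtain ⟨c, rfl⟩ := (hroots w).1 hw
    rwa [(component_eq_component _).2 (hvw.mono (Finset.erase_subset _ _)), hs]
  have hst : (G.spanningSubgraph S).component (G.src e) =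
      (G.spanningSubgraph S).component (G.tgt e) := (component_eq_component _).2
    ((G.spanningSubgraph S).reachable_src_tgt ⟨e, ha⟩)
  exact hS.not_reachable_erase ha ((hroot (G.tgt e)).trans (hst ▸ (hroot (G.src e)).symm))

/-! ### Spanning trees -/

theorem Connected.exists_isSpanningTree {G : SerreGraph V D} (hG : G.Connected) (hV : Nonempty V) :
    ∃ T, G.IsSpanningTree T := by
  have huniv : (G.spanningSubgraph Finset.univ).Connected := fun v w =>
    Relation.ReflTransGen.mono (fun _ _ ⟨e, he⟩ => ⟨⟨e, Finset.mem_univ _⟩, he⟩) _ _ (hG v w)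
  obtain ⟨v₀⟩ := hV
  obtain ⟨f, hf, -, hroots⟩ := G.exists_isParentMap_subset Finset.univ (fun _ => v₀) fun c => by
    obtain ⟨v, rfl⟩ : ∃ v, (G.spanningSubgraph Finset.univ).component v = c := Quotient.exists_rep c
    exact (component_eq_component _).2 (huniv v₀ v)
  have hroot : ∀ v, (G.spanningSubgraph (G.parentEdges f)).Reachable v v₀ := by
    intro v
    obtain ⟨w, hw, hvw⟩ := hf.exists_root (fun _ _ h => edge_mem_parentEdges h) v
    obtain ⟨_, hwv⟩ := (hroots w).1 hw
    rwa [← hwv] at hvw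
  exact ⟨G.parentEdges f, ⟨v₀⟩, fun v w => (hroot v).trans (hroot w).symm, hf.isSpanningForest⟩

open MvPolynomial in
theorem coeff_spanningTreePartition {G : SerreGraph V D} {T : Finset G.Edge}
    (hT : G.IsSpanningTree T) :
    coeff (∑ e ∈ T, Finsupp.single e 1)
      (G.spanningTreePartition (X : G.Edge → MvPolynomial G.Edge ℤ)) = 1 := by
  classical
  have hinj : ∀ S : Finset G.Edge, ∑ e ∈ S, Finsupp.single e 1 = ∑ e ∈ T, Finsupp.single e 1 →
      S = T := by
    intro S h
    ext e
    have := DFunLike.congr_fun h e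
    simp only [Finsupp.finsetSum_apply, Finsupp.single_apply, Finset.sum_ite_eq'] at this
    split_ifs at this <;> simp_all
  have hX : ∀ S : Finset G.Edge, ∏ e ∈ S, (X e : MvPolynomial G.Edge ℤ) =
      monomial (∑ e ∈ S, Finsupp.single e 1) 1 := fun S => (monomial_sum_one S _).symm
  simp only [spanningTreePartition, coeff_sum, hX, coeff_monomial]
  rw [Finset.sum_eq_single T (fun S _ hS => if_neg fun h => hS (hinj S h))
    fun h => absurd (Finset.mem_filter.2 ⟨Finset.mem_univ _, hT⟩) h, if_pos rfl]

end SerreGraph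

namespace SerreGraph

universe u v u' v' w

variable {V : Type u} {D : Type v} {V' : Type u'} {D' : Type v'} [Fintype V] [Fintype D]
  [Fintype V'] [Fintype D'] {R : Type w} [CommRing R]

/-! ### Counting parent maps -/

namespace IsParentMap

variable {G : SerreGraph V D} {f : V → Option D}

open scoped Classical in
theorem card_roots (hf : G.IsParentMap f) :
    (Finset.univ.filter fun v => f v = none).card =
      Fintype.card (G.spanningSubgraph (G.parentEdges f)).Component := by
  refine Finset.card_bij (fun v _ => (G.spanningSubgraph (G.parentEdges f)).component v)
    (fun _ _ => Finset.mem_univ _) (fun v hv w hw h => ?_) fun c _ => ?_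
  · exact hf.root_unique (Finset.mem_filter.1 hv).2 (Finset.mem_filter.1 hw).2
      ((component_eq_component _).1 h)
  · obtain ⟨v, ⟨hv, hc⟩, -⟩ := hf.existsUnique_root c
    exact ⟨v, Finset.mem_filter.2 ⟨Finset.mem_univ _, hv⟩, hc⟩

open scoped Classical in
/-- Each root contributes a factor `t`, and each other vertex the weight of its parent edge. -/
theorem prod_weight (hf : G.IsParentMap f) (x : G.Edge → R) (t : R) :
    ∏ v, (f v).elim t (fun e => x (G.edge e)) =
      t ^ Fintype.card (G.spanningSubgraph (G.parentEdges f)).Component *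
        ∏ a ∈ G.parentEdges f, x a := by
  rw [← Finset.prod_filter_mul_prod_filter_not Finset.univ fun v => f v = none]
  congr 1
  · rw [Finset.prod_congr rfl (g := fun _ => t), Finset.prod_const, hf.card_roots]
    intro v hv
    rw [(Finset.mem_filter.1 hv).2, Option.elim_none]
  · have hsome : ∀ v ∈ Finset.univ.filter (fun v => ¬ f v = none), ∃ e, f v = some e :=
      fun v hv => Option.ne_none_iff_exists'.1 (Finset.mem_filter.1 hv).2
    refine Finset.prod_bij (fun v hv => G.edge (hsome v hv).choose) (fun v hv => ?_)
      (fun v hv w hw h => ?_) (fun a ha => ?_) fun v hv => ?_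
    · exact edge_mem_parentEdges (hsome v hv).choose_spec
    · exact hf.edge_injective (hsome v hv).choose_spec (hsome w hw).choose_spec h
    · obtain ⟨v, e, he, rfl⟩ := mem_parentEdges.1 ha
      have hv : v ∈ Finset.univ.filter (fun v => ¬ f v = none) :=
        Finset.mem_filter.2 ⟨Finset.mem_univ _, by simp [he]⟩
      refine ⟨v, hv, ?_⟩
      rw [Option.some.inj ((hsome v hv).choose_spec.symm.trans he)]
    · conv_lhs => rw [(hsome v hv).choose_spec]
      rfl

end IsParentMap

open scoped Classical in
/-- A spanning forest is the set of edges of as many parent maps as there are choices of a root in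
each of its components. -/
theorem IsSpanningForest.card_isParentMap {G : SerreGraph V D} {S : Finset G.Edge}
    (hS : G.IsSpanningForest S) :
    (Finset.univ.filter fun f : V → Option D => G.IsParentMap f ∧ G.parentEdges f = S).card =
      (G.spanningSubgraph S).numRoots := by
  have huniq : ∀ f : {f : V → Option D // G.IsParentMap f ∧ G.parentEdges f = S},
      ∀ c, ∃! v, f.1 v = none ∧ (G.spanningSubgraph S).component v = c := by
    rintro ⟨f, hf, rfl⟩
    exact hf.existsUnique_root
  choose ρ hρ hρu using huniq
  let Φ : {f : V → Option D // G.IsParentMap f ∧ G.parentEdges f = S} →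
      ((c : (G.spanningSubgraph S).Component) →
        {v : V // (G.spanningSubgraph S).component v = c}) := fun f c => ⟨ρ f c, (hρ f c).2⟩
  have hΦ : Function.Bijective Φ := by
    constructor
    · intro f f' h
      have hc : ∀ c, ρ f c = ρ f' c := fun c => congrArg Subtype.val (congrFun h c)
      refine Subtype.ext (f.2.1.eq_of_parentEdges_eq f'.2.1 (f.2.2.trans f'.2.2.symm) fun v => ?_)
      constructor
      · intro hv
        rw [hρu f _ v ⟨hv, rfl⟩, hc]
        exact (hρ f' _).1
      · intro hv
        rw [hρu f' _ v ⟨hv, rfl⟩, ← hc]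
        exact (hρ f _).1
    · intro s
      obtain ⟨f, hf, hE, hroot⟩ := hS.exists_isParentMap (fun c => (s c).1) fun c => (s c).2
      refine ⟨⟨f, hf, hE⟩, funext fun c => Subtype.ext ?_⟩
      exact (hρu ⟨f, hf, hE⟩ c _ ⟨(hroot _).2 ⟨c, rfl⟩, (s c).2⟩).symm
  rw [numRoots, ← Nat.card_pi, ← Nat.card_congr (Equiv.ofBijective Φ hΦ),
    Nat.card_eq_fintype_card, Fintype.card_subtype]

/-! ### The matrix-forest theorem -/

open scoped Classical in
/-- The weighted Laplacian matrix. Its row at `v` is a sum over the directed edges leaving `v`;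
loops contribute zero. -/
noncomputable def laplacian (G : SerreGraph V D) (x : G.Edge → R) : Matrix V V R :=
  Matrix.of fun v w => ∑ e with G.src e = v,
    x (G.edge e) * ((if v = w then 1 else 0) - if G.tgt e = w then 1 else 0)

open scoped Classical in
/-- The generating function of rooted spanning forests, in which the exponent of `t` is the number
of components. -/
noncomputable def forestPolynomial (G : SerreGraph V D) (x : G.Edge → R) (t : R) : R :=
  ∑ F : Finset G.Edge with G.IsSpanningForest F,
    t ^ Fintype.card (G.spanningSubgraph F).Component *
      (((G.spanningSubgraph F).numRoots : R) * ∏ e ∈ F, x e)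

open scoped Classical in
theorem forestPolynomial_eq_sum_isParentMap (G : SerreGraph V D) (x : G.Edge → R) (t : R) :
    G.forestPolynomial x t = ∑ f : V → Option D with G.IsParentMap f,
      ∏ v, (f v).elim t (fun e => x (G.edge e)) := by
  rw [forestPolynomial, ← Finset.sum_fiberwise_of_maps_to (g := G.parentEdges)
    (t := Finset.univ.filter fun F => G.IsSpanningForest F)
    fun f hf => Finset.mem_filter.2 ⟨Finset.mem_univ _,
      (Finset.mem_filter.1 hf).2.isSpanningForest⟩]
  refine Finset.sum_congr rfl fun F hF => ?_
  rw [Finset.filter_filter, ← (Finset.mem_filter.1 hF).2.card_isParentMap, mul_left_comm,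
    ← nsmul_eq_mul]
  refine (Finset.sum_eq_card_nsmul fun f hf => ?_).symm
  obtain ⟨-, h, rfl⟩ := Finset.mem_filter.1 hf
  exact h.prod_weight x t

open scoped Classical in
/-- The matrix-forest theorem. Each row of the matrix is a combination of one row for each directed
edge leaving the vertex and one for `t`. The expansion by multilinearity runs over all maps choosing
one of these at each vertex, and the determinant of such a choice is `1` if following the chosen
edges does not lead into a cycle, and `0` otherwise. -/
theorem det_laplacian (G : SerreGraph V D) (x : G.Edge → R) (t : R) :
    (t • 1 + G.laplacian x).det = G.forestPolynomial x t := by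
  let A : V → Finset (Option D) := fun v =>
    Finset.univ.filter fun o => ∀ e, o = some e → G.src e = v
  let wt : Option D → R := fun o => o.elim t fun e => x (G.edge e)
  let row : V → Option D → V → R := fun v o w =>
    (if v = w then 1 else 0) - if o.map G.tgt = some w then 1 else 0
  have hrow : t • 1 + G.laplacian x = Matrix.of fun v => ∑ o ∈ A v, wt o • row v o := by
    ext v w
    rw [Matrix.of_apply, Finset.sum_apply, Finset.sum_filter, Fintype.sum_option, laplacian,
      Matrix.add_apply, Matrix.of_apply, Finset.sum_filter]
    simp [wt, row, Matrix.one_apply]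
  rw [hrow, forestPolynomial_eq_sum_isParentMap]
  change Matrix.detRowAlternating.toMultilinearMap (fun v => ∑ o ∈ A v, wt o • row v o) = _
  rw [MultilinearMap.map_sum_finset]
  simp only [MultilinearMap.map_smul_univ]
  have hA : (Finset.univ.filter fun f : V → Option D => G.IsParentMap f) ⊆ Fintype.piFinset A := by
    intro f hf
    refine Fintype.mem_piFinset.2 fun v => Finset.mem_filter.2 ⟨Finset.mem_univ _, ?_⟩
    exact (Finset.mem_filter.1 hf).2.src_eq v
  rw [← Finset.sum_subset hA]
  · refine Finset.sum_congr rfl fun f hf => ?_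
    have h : Matrix.det (Matrix.of fun v => row v (f v)) = 1 :=
      Matrix.det_eq_one_of_wellFounded (fun v => (f v).map G.tgt) (fun _ _ => rfl)
        (Finset.mem_filter.1 hf).2.wf
    change _ • Matrix.det (Matrix.of fun v => row v (f v)) = _
    rw [h, smul_eq_mul, mul_one]
  · intro f hf hnf
    have hsrc : ∀ v e, f v = some e → G.src e = v := fun v =>
      (Finset.mem_filter.1 (Fintype.mem_piFinset.1 hf v)).2
    have h : Matrix.det (Matrix.of fun v => row v (f v)) = 0 :=
      Matrix.det_eq_zero_of_not_wellFounded (fun v => (f v).map G.tgt) (fun _ _ => rfl) fun hwf =>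
        hnf (Finset.mem_filter.2 ⟨Finset.mem_univ _, hsrc, hwf⟩)
    change _ • Matrix.det (Matrix.of fun v => row v (f v)) = _
    rw [h, smul_zero]

/-! ### Coverings -/

theorem Hom.IsCovering.forestPolynomial_dvd {G : SerreGraph V D} {G' : SerreGraph V' D'}
    {p : G'.Hom G} (hp : p.IsCovering) (x : G.Edge → R) (t : R) :
    G.forestPolynomial x t ∣ G'.forestPolynomial (p.liftWeight x) t := by
  classical
  rw [← det_laplacian, ← det_laplacian]
  refine Matrix.det_dvd_det_of_sum_fiber _ _ hp.surjective fun v' w => ?_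
  have hδ : ∀ u : V', ∑ w' with p.onVert w' = w, (if u = w' then (1 : R) else 0) =
      if p.onVert u = w then 1 else 0 := by
    intro u
    simp
  simp only [Matrix.add_apply, Matrix.smul_apply, Matrix.one_apply, laplacian, Matrix.of_apply,
    Finset.sum_add_distrib, smul_eq_mul]
  rw [← Finset.mul_sum, Finset.sum_comm, hδ]
  simp only [← Finset.mul_sum, Finset.sum_sub_distrib, hδ]
  congr 1
  refine Finset.sum_bij (fun e _ => p.onDart e) (fun e he => ?_) (fun e he f hf h => ?_)
    (fun e he => ?_) fun e he => ?_
  · simpa using (hp.bijOn_src v').mapsTo (by simpa using he)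
  · exact (hp.bijOn_src v').injOn (by simpa using he) (by simpa using hf) h
  · obtain ⟨a, ha, rfl⟩ := (hp.bijOn_src v').surjOn (by simpa using he)
    exact ⟨a, by simpa using ha, rfl⟩
  · rw [p.tgt_onDart]
    rfl

theorem forestPolynomial_one (G : SerreGraph V D) (x : G.Edge → R) :
    G.forestPolynomial x 1 = G.rootedSpanningForestPartition x := by
  simp [forestPolynomial, rootedSpanningForestPartition]

open Polynomial in
theorem coeff_zero_forestPolynomial (hV : Nonempty V) (G : SerreGraph V D) (x : G.Edge → R) :
    (G.forestPolynomial (fun e => C (x e)) X).coeff 0 = 0 := by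
  simp only [forestPolynomial, finsetSum_coeff, ← map_natCast (C : R →+* R[X]), ← map_prod,
    ← map_mul, coeff_X_pow_mul']
  refine Finset.sum_eq_zero fun F _ => if_neg ?_
  have : Nonempty (G.spanningSubgraph F).Component := hV.map (G.spanningSubgraph F).component
  exact not_le.2 Fintype.card_pos

open scoped Classical in
open Polynomial in
/-- The linear term of the forest polynomial counts the forests with only one component. -/
theorem coeff_one_forestPolynomial (G : SerreGraph V D) (x : G.Edge → R) :
    (G.forestPolynomial (fun e => C (x e)) X).coeff 1 =
      Fintype.card V * G.spanningTreePartition x := by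
  simp only [forestPolynomial, finsetSum_coeff, ← map_natCast (C : R →+* R[X]), ← map_prod,
    ← map_mul, coeff_mul_C, coeff_X_pow, ite_mul, one_mul, zero_mul]
  rw [← Finset.sum_filter, Finset.filter_filter, spanningTreePartition, Finset.mul_sum]
  refine Finset.sum_congr (Finset.filter_congr fun F _ => ?_) fun F hF => ?_
  · rw [eq_comm (a := 1), card_component_eq_one_iff, IsSpanningTree, IsSpanningForest]
    tauto
  · obtain ⟨hV, h, -⟩ := (Finset.mem_filter.1 hF).2
    rw [numRoots_of_connected hV h]

open Polynomial in
theorem Hom.IsCovering.spanningTreePartition_dvd_card_mul {G : SerreGraph V D}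
    {G' : SerreGraph V' D'} {p : G'.Hom G} (hp : p.IsCovering) (x : G.Edge → R) :
    G.spanningTreePartition x ∣
      (Fintype.card V' : R) * G'.spanningTreePartition (p.liftWeight x) := by
  cases isEmpty_or_nonempty V' with
  | inl h => simp
  | inr h =>
    obtain ⟨q, hq⟩ := hp.forestPolynomial_dvd (fun e => C (x e)) X
    have h1 := congrArg (fun P => P.coeff 1) hq
    simp only [mul_coeff_one, coeff_zero_forestPolynomial (h.map p.onVert), zero_mul, zero_add,
      coeff_one_forestPolynomial] at h1
    have h2 : p.liftWeight (fun e => C (x e)) = fun e => C (p.liftWeight x e) := rfl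
    rw [h2, coeff_one_forestPolynomial] at h1
    rw [h1]
    exact ⟨Fintype.card V * q.coeff 0, by ring⟩

end SerreGraph

/-! ### Gauss's lemma -/

open MvPolynomial in
/-- Gauss's lemma for a polynomial having `1` among its coefficients. -/
theorem MvPolynomial.dvd_of_dvd_natCast_mul {σ : Type*} {P Q : MvPolynomial σ ℤ} {m : σ →₀ ℕ}
    (hP : P.coeff m = 1) {n : ℕ} (hn : n ≠ 0) (h : P ∣ (n : MvPolynomial σ ℤ) * Q) : P ∣ Q := by
  induction n using Nat.recOnMul generalizing Q with
  | zero => exact absurd rfl hn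
  | one => simpa using h
  | prime q hq =>
    obtain ⟨A, hA⟩ := h
    have hqC : ((q : ℕ) : MvPolynomial σ ℤ) = C (q : ℤ) := by simp
    have hpr : Prime (C (q : ℤ) : MvPolynomial σ ℤ) :=
      (prime_C_iff σ).2 (Nat.prime_iff_prime_int.1 hq)
    rw [hqC] at hA
    rcases hpr.dvd_or_dvd ⟨Q, hA.symm⟩ with h1 | ⟨B, rfl⟩
    · have := (C_dvd_iff_dvd_coeff _ _).1 h1 m
      rw [hP] at this
      exact absurd (isUnit_of_dvd_one this) (Nat.prime_iff_prime_int.1 hq).not_isUnit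
    · exact ⟨B, mul_left_cancel₀ hpr.ne_zero (by rw [hA]; ring)⟩
  | mul a b iha ihb =>
    rw [Nat.cast_mul, mul_assoc] at h
    exact ihb (right_ne_zero_of_mul hn) (iha (left_ne_zero_of_mul hn) h)

/-! ### Divisibility of partition functions -/

theorem mainTheorem2 {V D V' D' : Type*} [Fintype V] [Fintype D] [Fintype V'] [Fintype D']
    (G : SerreGraph V D) (G' : SerreGraph V' D') (hG : G.Connected)
    (p : G'.Hom G) (hp : p.IsCovering) :
    G.spanningTreePartition (MvPolynomial.X : G.Edge → MvPolynomial G.Edge ℤ) ∣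
        G'.spanningTreePartition (p.liftWeight MvPolynomial.X) ∧
      G.rootedSpanningForestPartition (MvPolynomial.X : G.Edge → MvPolynomial G.Edge ℤ) ∣
        G'.rootedSpanningForestPartition (p.liftWeight MvPolynomial.X) := by
  classical
  constructor
  · cases isEmpty_or_nonempty V' with
    | inl h =>
      have : G'.spanningTreePartition (p.liftWeight
          (MvPolynomial.X : G.Edge → MvPolynomial G.Edge ℤ)) = 0 := by
        rw [SerreGraph.spanningTreePartition]
        refine Finset.sum_eq_zero fun T hT => ?_
        exact isEmptyElim (Finset.mem_filter.1 hT).2.1.some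
      rw [this]
      exact dvd_zero _
    | inr h =>
      obtain ⟨T, hT⟩ := hG.exists_isSpanningTree (h.map p.onVert)
      exact MvPolynomial.dvd_of_dvd_natCast_mul (SerreGraph.coeff_spanningTreePartition hT)
        Fintype.card_ne_zero (hp.spanningTreePartition_dvd_card_mul _)
  · rw [← SerreGraph.forestPolynomial_one, ← SerreGraph.forestPolynomial_one]
    exact hp.forestPolynomial_dvd _ _
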